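/- Let $n\ge 0$ and let $q\in\mathbb{C}[z_1,\dots,z_n]$ be a holomorphic polynomial with $q(0)=0$ and $|q(z)|<1$ for every $z$ in the closed Euclidean unit ball of $\mathbb{C}^n$. Then there are an integer $N\ge 0$ and a holomorphic polynomial map $p=(p_1,\dots,p_N):\mathbb{C}^n\to\mathbb{C}^N$ such that (i) $p/(1+q)$ is a proper rational map between the open unit balls $B_n\subset\mathbb{C}^n$ and $B_N\subset\mathbb{C}^N$: the polynomial $1+q$ has no zero in $B_n$, the map $z\mapsto p(z)/(1+q(z))$ maps $B_n$ into $B_N$, and it is proper as a map $B_n\to B_N$ (the inverse image of every compact subset of $B_N$ is compact); (ii) $p/(1+q)$ is reduced to lowest terms: every polynomial in $\mathbb{C}[z_1,\dots,z_n]$ that divides $1+q$ and all of $p_1,\dots,p_N$ is a non-zero constant. (In particular, if $q\ne 0$, then $1+q$ does not divide all the components of $p$.) -/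

import Mathlib

noncomputable section

/-- The open unit ball `B_n` of `ℂⁿ` with the Euclidean norm. -/
abbrev unitBall (n : ℕ) : Set (EuclideanSpace ℂ (Fin n)) := Metric.ball 0 1

/-- The closed unit ball of `ℂⁿ` with the Euclidean norm. -/
abbrev closedUnitBall (n : ℕ) : Set (EuclideanSpace ℂ (Fin n)) := Metric.closedBall 0 1

/-- The value of a holomorphic polynomial in `n` variables at a point of `ℂⁿ`. -/
def polyEval {n : ℕ} (f : MvPolynomial (Fin n) ℂ) (z : EuclideanSpace ℂ (Fin n)) : ℂ :=
  MvPolynomial.eval (fun j => z j) f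

/-- The function `z ↦ p(z) / r(z)` from `ℂⁿ` to `ℂᴺ`, meaningful where `r(z) ≠ 0`. -/
def quotientMap {n N : ℕ} (p : Fin N → MvPolynomial (Fin n) ℂ) (r : MvPolynomial (Fin n) ℂ)
    (z : EuclideanSpace ℂ (Fin n)) : EuclideanSpace ℂ (Fin N) :=
  WithLp.toLp 2 (fun i => polyEval (p i) z / polyEval r z)

/-- `p / r` is a proper rational map between balls: the denominator has no zero in `B_n`, the
quotient maps `B_n` into `B_N`, and as a map from `B_n` to `B_N` it is proper. -/
def IsProperRationalBallMap {n N : ℕ} (p : Fin N → MvPolynomial (Fin n) ℂ)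
    (r : MvPolynomial (Fin n) ℂ) : Prop :=
  (∀ z ∈ unitBall n, polyEval r z ≠ 0) ∧
    ∃ h : Set.MapsTo (quotientMap p r) (unitBall n) (unitBall N), IsProperMap h.restrict

/-- `p / r` is reduced to lowest terms: a polynomial dividing the denominator and all the
components of the numerator is a unit, that is, a non-zero constant. -/
def IsReducedToLowestTerms {n N : ℕ} (p : Fin N → MvPolynomial (Fin n) ℂ)
    (r : MvPolynomial (Fin n) ℂ) : Prop :=
  ∀ h : MvPolynomial (Fin n) ℂ, h ∣ r → (∀ i, h ∣ p i) → IsUnit h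

end

/-! Put r = 1 + q, which has no zero on the closed ball. For small ε > 0, |r|² - 2ε² is positive on
the unit sphere, hence equals there a sum of squared norms of holomorphic polynomials (the Quillen
and Catlin–D'Angelo theorem, `mem_sphereSquares_of_pos`). Since ε² + ∑ |ε z_k|² = 2ε² on the sphere,
adjoining the components ε and ε z_k gives p with ‖p‖ = |r| there. The constant ε puts p / r in
lowest terms, the ε z_k make p / r nonconstant for n ≥ 1, the maximum principle sends ball to ball,
and unit norm on the sphere gives properness.

The positivity theorem follows from Kadison–Dubois (`mem_of_forall_algHom_pos`): sums of squared
norms form an archimedean semiring, and the real characters nonnegative on it are evaluations at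
points of the sphere. -/

/-! ### Kadison–Dubois representation theorem -/

/-- The states of a real algebra `A` with respect to a cone `P`: the normalized linear functionals
that are nonnegative on `P`, as a set of functions on `A`. -/
def stateSet {A : Type*} [CommRing A] [Algebra ℝ A] (P : Subsemiring A) : Set (A → ℝ) :=
  {φ | (∀ x y, φ (x + y) = φ x + φ y) ∧ (∀ (c : ℝ) x, φ (c • x) = c * φ x) ∧ φ 1 = 1 ∧
    ∀ x ∈ P, 0 ≤ φ x}

/-- The archimedean property confines each φ(a) to a fixed interval, so Tychonoff applies. -/
theorem isCompact_stateSet {A : Type*} [CommRing A] [Algebra ℝ A] (P : Subsemiring A)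
    (harch : ∀ a, ∃ N : ℝ, algebraMap ℝ A N + a ∈ P) : IsCompact (stateSet P) := by
  choose N hN using harch
  have hclosed : IsClosed (stateSet P) := by
    simp only [stateSet, Set.ofPred_and, Set.ofPred_forall]
    refine IsClosed.inter ?_ (IsClosed.inter ?_ (IsClosed.inter ?_ ?_))
    · exact isClosed_iInter fun x => isClosed_iInter fun y =>
        isClosed_eq (by fun_prop) (by fun_prop)
    · exact isClosed_iInter fun c => isClosed_iInter fun x =>
        isClosed_eq (by fun_prop) (by fun_prop)
    · exact isClosed_eq (by fun_prop) (by fun_prop)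
    · exact isClosed_iInter fun x => isClosed_iInter fun _ =>
        isClosed_le (by fun_prop) (by fun_prop)
  refine IsCompact.of_isClosed_subset
    (isCompact_univ_pi fun a : A => isCompact_Icc (a := -N a) (b := N (-a))) hclosed ?_
  rintro φ ⟨hadd, hsmul, h1, hpos⟩ a -
  have key : ∀ b, 0 ≤ N b + φ b := fun b => by
    have := hpos _ (hN b)
    rwa [hadd, Algebra.algebraMap_eq_smul_one, hsmul, h1, mul_one] at this
  have hneg : φ (-a) = -φ a := by simpa using hsmul (-1) a
  have h2 := key (-a)
  exact ⟨by linarith [key a], by linarith⟩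

/-- Separation: the functional c · 1 ↦ c is nonnegative on the part of the cone P - ℝ≥0 a lying in ℝ
· 1, and Riesz extension makes it a state. -/
theorem exists_state_nonpos {A : Type*} [CommRing A] [Algebra ℝ A] (P : Subsemiring A)
    (hconst : ∀ c : ℝ, 0 ≤ c → algebraMap ℝ A c ∈ P)
    (harch : ∀ a, ∃ N : ℝ, algebraMap ℝ A N + a ∈ P) {a : A} (ha : a ∉ P) :
    ∃ φ ∈ stateSet P, φ a ≤ 0 := by
  have hsmul : ∀ c : ℝ, 0 ≤ c → ∀ x ∈ P, c • x ∈ P := fun c hc x hx => by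
    rw [Algebra.smul_def]; exact P.mul_mem (hconst c hc) hx
  let C : ConvexCone ℝ A :=
    { carrier := {x | ∃ p ∈ P, ∃ s : ℝ, 0 ≤ s ∧ x = p - s • a}
      smul_mem' := by
        rintro c hc _ ⟨p, hp, s, hs, rfl⟩
        exact ⟨c • p, hsmul c hc.le p hp, c * s, by positivity, by rw [smul_sub, mul_smul]⟩
      add_mem' := by
        rintro _ ⟨p, hp, s, hs, rfl⟩ _ ⟨p', hp', s', hs', rfl⟩
        exact ⟨p + p', P.add_mem hp hp', s + s', by positivity, by rw [add_smul]; abel⟩ }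
  have hneg : ∀ c : ℝ, algebraMap ℝ A c ∈ C → 0 ≤ c := by
    rintro c ⟨p, hp, s, hs, h⟩
    by_contra! hc
    apply ha
    have hsa : s • a ∈ P := by
      have : s • a = p + algebraMap ℝ A (-c) := by rw [map_neg, h]; abel
      rw [this]
      exact P.add_mem hp (hconst _ (by linarith))
    -- If s = 0, the negative constant c lies in P, so P contains every negative constant, and N + a
    -- ∈ P yields a ∈ P.
    rcases hs.eq_or_lt with rfl | hs
    · obtain ⟨N, hN⟩ := harch a
      have hp' : algebraMap ℝ A c ∈ P := by simpa [h] using hp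
      have h1 : (|N| / -c) • algebraMap ℝ A c ∈ P :=
        hsmul _ (div_nonneg (abs_nonneg _) (by linarith)) _ hp'
      have h2 := P.add_mem (P.add_mem hN (hconst (|N| - N) (by linarith [le_abs_self N]))) h1
      have h3 : (|N| / -c) * c = -|N| := by
        rw [div_neg, neg_mul, div_mul_cancel₀ _ hc.ne]
      rw [Algebra.smul_def, ← map_mul, h3, map_neg, map_sub] at h2
      convert h2 using 1
      abel
    · have := hsmul s⁻¹ (by positivity) _ hsa
      rwa [inv_smul_smul₀ hs.ne'] at this
  have h1 : (1 : A) ≠ 0 := fun h => by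
    have hA : Subsingleton A := subsingleton_of_zero_eq_one h.symm
    exact ha (by rw [Subsingleton.elim a 0]; exact P.zero_mem)
  have hgen : ∀ (c : ℝ) (hc : c • (1 : A) ∈
      (LinearPMap.mkSpanSingleton (σ := RingHom.id ℝ) (1 : A) (1 : ℝ) h1).domain),
      LinearPMap.mkSpanSingleton (σ := RingHom.id ℝ) (1 : A) (1 : ℝ) h1 ⟨c • 1, hc⟩ = c := by
    intro c hc
    exact (LinearPMap.mkSpanSingleton'_apply _ _ _ c hc).trans (by simp)
  have hC0 : C.Pointed := ⟨0, P.zero_mem, 0, le_rfl, by simp⟩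
  obtain ⟨g, hg, hgC⟩ := riesz_extension (C.toPointedCone hC0)
    (LinearPMap.mkSpanSingleton (1 : A) (1 : ℝ) h1)
    (by
      rintro ⟨x, hx⟩ hxC
      obtain ⟨c, rfl⟩ := Submodule.mem_span_singleton.1 hx
      rw [hgen]
      exact hneg c (by rwa [Algebra.algebraMap_eq_smul_one]))
    (by
      intro y
      obtain ⟨N, hN⟩ := harch y
      refine ⟨⟨N • 1, Submodule.mem_span_singleton.2 ⟨N, rfl⟩⟩, _, hN, 0, le_rfl, ?_⟩
      simp [Algebra.algebraMap_eq_smul_one])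
  refine ⟨g, ⟨map_add g, fun c x => by simp, ?_, fun x hx => hgC x ⟨x, hx, 0, le_rfl, by simp⟩⟩, ?_⟩
  · have := (hg ⟨(1 : ℝ) • (1 : A), Submodule.mem_span_singleton.2 ⟨1, rfl⟩⟩).trans (hgen 1 _)
    simpa using this
  · have := hgC (-a) ⟨0, P.zero_mem, 1, zero_le_one, by simp⟩
    rw [map_neg] at this
    linarith

/-- For p ∈ P with φ(p) > 0 and N - p ∈ P, the state φ is a convex combination of the normalized
functionals φ(p ·) and φ((N - p) ·). Extremality gives φ(p y) = φ(p) φ(y), and N + x ∈ P extends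
this to all x. -/
theorem mul_of_mem_extremePoints_stateSet {A : Type*} [CommRing A] [Algebra ℝ A]
    (P : Subsemiring A) (harch : ∀ a, ∃ N : ℝ, algebraMap ℝ A N + a ∈ P)
    (hconst : ∀ c : ℝ, 0 ≤ c → algebraMap ℝ A c ∈ P)
    {φ : A → ℝ} (hφ : φ ∈ (stateSet P).extremePoints ℝ) (x y : A) :
    φ (x * y) = φ x * φ y := by
  obtain ⟨⟨hadd, hsmul, h1, hpos⟩, hext⟩ := hφ
  have halg : ∀ c x, φ (algebraMap ℝ A c * x) = c * φ x := fun c x => by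
    rw [← Algebra.smul_def, hsmul]
  have halg1 : ∀ c, φ (algebraMap ℝ A c) = c := fun c => by simpa [h1] using halg c 1
  have hneg : ∀ x, φ (-x) = -φ x := fun x => by simpa using hsmul (-1) x
  have hsub : ∀ x y, φ (x - y) = φ x - φ y := fun x y => by rw [sub_eq_add_neg, hadd, hneg]; ring
  have hstate : ∀ p ∈ P, 0 < φ p → (fun z => (φ p)⁻¹ * φ (p * z)) ∈ stateSet P := by
    intro p hp h0
    refine ⟨fun z w => by simp only [mul_add, hadd], fun c z => by
      simp only [mul_smul_comm, hsmul]; ring, by simp [h0.ne'], fun z hz => ?_⟩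
    exact mul_nonneg (by positivity) (hpos _ (P.mul_mem hp hz))
  have key : ∀ p ∈ P, φ (p * y) = φ p * φ y := by
    intro p hp
    rcases (hpos p hp).eq_or_lt with h0 | h0
    -- When φ(p) = 0, the bounds -M ≤ y ≤ M' multiplied by p force φ(p y) = 0.
    · obtain ⟨M, hM⟩ := harch y
      obtain ⟨M', hM'⟩ := harch (-y)
      have e1 := hpos _ (P.mul_mem hp hM)
      have e2 := hpos _ (P.mul_mem hp hM')
      rw [mul_add, hadd, mul_comm p, halg, ← h0] at e1 e2
      rw [mul_neg, hneg] at e2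
      rw [← h0]
      linarith
    · obtain ⟨N₀, hN₀⟩ := harch (-p)
      obtain ⟨N, hN, hpN⟩ : ∃ N : ℝ, φ p < N ∧ algebraMap ℝ A N - p ∈ P := by
        refine ⟨N₀ + 1, ?_, ?_⟩
        · have := hpos _ hN₀
          rw [hadd, hneg, halg1] at this
          linarith
        · have := P.add_mem hN₀ (hconst 1 zero_le_one)
          rw [map_add]
          convert this using 1
          abel
      have hN0 : 0 < N := h0.trans hN
      have hr : φ (algebraMap ℝ A N - p) = N - φ p := by rw [hsub, halg1]
      have h := hext (hstate p hp h0) (hstate _ hpN (by rw [hr]; linarith))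
        ⟨φ p / N, (N - φ p) / N, by positivity, div_pos (by linarith) hN0, by field_simp; ring, by
          funext z
          have : N - φ p ≠ 0 := by linarith
          simp only [Pi.add_apply, Pi.smul_apply, smul_eq_mul, hr, sub_mul, hsub, halg]
          field_simp
          ring⟩
      have := congrFun h y
      rw [← this]
      field_simp
  obtain ⟨N, hN⟩ := harch x
  have := key _ hN
  rw [add_mul, hadd, hadd, halg, halg1] at this
  linarith

/-- The Kadison–Dubois representation theorem for an archimedean semiring in a real algebra. -/
theorem mem_of_forall_algHom_pos {A : Type*} [CommRing A] [Algebra ℝ A] (P : Subsemiring A)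
    (hconst : ∀ c : ℝ, 0 ≤ c → algebraMap ℝ A c ∈ P)
    (harch : ∀ a, ∃ N : ℝ, algebraMap ℝ A N + a ∈ P) (a : A)
    (ha : ∀ φ : A →ₐ[ℝ] ℝ, (∀ x ∈ P, 0 ≤ φ x) → 0 < φ a) : a ∈ P := by
  by_contra haP
  obtain ⟨ψ, hψ, hψa⟩ := exists_state_nonpos P hconst harch haP
  have hK := isCompact_stateSet P harch
  -- The states minimizing evaluation at a form an exposed face; by Krein–Milman it has an extreme
  -- point, which is a character with value at most ψ(a) ≤ 0.
  let F : Set (A → ℝ) := {φ | φ ∈ stateSet P ∧ ∀ χ ∈ stateSet P, φ a ≤ χ a}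
  have hF : IsExposed ℝ (stateSet P) F := fun _ =>
    ⟨-ContinuousLinearMap.proj (R := ℝ) (φ := fun _ : A => ℝ) a, by simp [F]⟩
  have hFne : F.Nonempty := by
    obtain ⟨φ, hφ, hmin⟩ := hK.exists_isMinOn ⟨ψ, hψ⟩ (continuous_apply a).continuousOn
    exact ⟨φ, hφ, fun χ hχ => hmin hχ⟩
  obtain ⟨φ, hφF⟩ := (hF.isCompact hK).extremePoints_nonempty hFne
  have hφ := hF.isExtreme.extremePoints_subset_extremePoints hφF
  have hmul := mul_of_mem_extremePoints_stateSet P harch hconst hφ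
  have hle : φ a ≤ ψ a := hφF.1.2 ψ hψ
  obtain ⟨⟨hadd, hsmul, h1, hpos⟩, -⟩ := hφ
  let f : A →ₗ[ℝ] ℝ := { toFun := φ, map_add' := hadd, map_smul' := fun c x => hsmul c x }
  have := ha (AlgHom.ofLinearMap f h1 hmul) hpos
  exact absurd this (not_lt.2 (hle.trans hψa))

/-! ### Evaluation of holomorphic polynomials -/

theorem polyEval_add {n : ℕ} (f g : MvPolynomial (Fin n) ℂ) (z : EuclideanSpace ℂ (Fin n)) :
    polyEval (f + g) z = polyEval f z + polyEval g z := by simp [polyEval]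

theorem polyEval_mul {n : ℕ} (f g : MvPolynomial (Fin n) ℂ) (z : EuclideanSpace ℂ (Fin n)) :
    polyEval (f * g) z = polyEval f z * polyEval g z := by simp [polyEval]

theorem polyEval_one {n : ℕ} (z : EuclideanSpace ℂ (Fin n)) :
    polyEval (1 : MvPolynomial (Fin n) ℂ) z = 1 := by simp [polyEval]

theorem polyEval_C {n : ℕ} (c : ℂ) (z : EuclideanSpace ℂ (Fin n)) :
    polyEval (MvPolynomial.C c : MvPolynomial (Fin n) ℂ) z = c := by simp [polyEval]

theorem polyEval_X {n : ℕ} (j : Fin n) (z : EuclideanSpace ℂ (Fin n)) :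
    polyEval (MvPolynomial.X j : MvPolynomial (Fin n) ℂ) z = z j := by simp [polyEval]

theorem differentiable_polyEval {n : ℕ} (f : MvPolynomial (Fin n) ℂ) :
    Differentiable ℂ (polyEval f) := by
  induction f using MvPolynomial.induction_on with
  | C a => simp only [funext (polyEval_C a)]; fun_prop
  | add p q hp hq => simp only [funext (polyEval_add p q)]; fun_prop
  | mul_X p j hp =>
    simp only [funext (polyEval_mul p (MvPolynomial.X j)), polyEval_X]
    exact hp.mul (EuclideanSpace.proj (𝕜 := ℂ) j).differentiable

/-! ### Sums of squared norms on the sphere -/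

/-- The real and imaginary parts of the coordinates of a point of `ℂⁿ`. -/
def realCoord {n : ℕ} (z : EuclideanSpace ℂ (Fin n)) : Fin n ⊕ Fin n → ℝ :=
  Sum.elim (fun j => (z j).re) (fun j => (z j).im)

/-- The real polynomials in the real coordinates of `ℂⁿ` that agree on the unit sphere with a sum
of squared norms of holomorphic polynomials. -/
def sphereSquares (n : ℕ) : Subsemiring (MvPolynomial (Fin n ⊕ Fin n) ℝ) where
  carrier := {a | ∃ (ι : Type) (_ : Fintype ι) (p : ι → MvPolynomial (Fin n) ℂ),
    ∀ z ∈ Metric.sphere (0 : EuclideanSpace ℂ (Fin n)) 1,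
      MvPolynomial.eval (realCoord z) a = ∑ i, ‖polyEval (p i) z‖ ^ 2}
  zero_mem' := ⟨Empty, inferInstance, fun _ => 0, fun z _ => by simp⟩
  one_mem' := ⟨Unit, inferInstance, fun _ => 1, fun z _ => by simp [polyEval_one]⟩
  add_mem' := by
    rintro a b ⟨ι, _, p, hp⟩ ⟨κ, _, r, hr⟩
    exact ⟨ι ⊕ κ, inferInstance, Sum.elim p r, fun z hz => by simp [hp z hz, hr z hz]⟩
  mul_mem' := by
    rintro a b ⟨ι, _, p, hp⟩ ⟨κ, _, r, hr⟩
    refine ⟨ι × κ, inferInstance, fun i => p i.1 * r i.2, fun z hz => ?_⟩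
    simp [hp z hz, hr z hz, polyEval_mul, mul_pow, Fintype.sum_prod_type, Finset.sum_mul_sum]

theorem mem_sphereSquares {n : ℕ} {a : MvPolynomial (Fin n ⊕ Fin n) ℝ} :
    a ∈ sphereSquares n ↔ ∃ (ι : Type) (_ : Fintype ι) (p : ι → MvPolynomial (Fin n) ℂ),
      ∀ z ∈ Metric.sphere (0 : EuclideanSpace ℂ (Fin n)) 1,
        MvPolynomial.eval (realCoord z) a = ∑ i, ‖polyEval (p i) z‖ ^ 2 := Iff.rfl

theorem C_mem_sphereSquares {n : ℕ} {c : ℝ} (hc : 0 ≤ c) :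
    MvPolynomial.C c ∈ sphereSquares n :=
  ⟨Unit, inferInstance, fun _ => MvPolynomial.C (√c : ℂ), fun z _ => by
    simp [polyEval_C, Real.sq_sqrt hc]⟩

theorem mem_sphereSquares_of_eq_zero {n : ℕ} {a : MvPolynomial (Fin n ⊕ Fin n) ℝ}
    (ha : ∀ z ∈ Metric.sphere (0 : EuclideanSpace ℂ (Fin n)) 1,
      MvPolynomial.eval (realCoord z) a = 0) : a ∈ sphereSquares n :=
  ⟨Empty, inferInstance, fun _ => 0, fun z hz => by simp [ha z hz]⟩

theorem sum_norm_sq_eq_one {n : ℕ} {z : EuclideanSpace ℂ (Fin n)}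
    (hz : z ∈ Metric.sphere (0 : EuclideanSpace ℂ (Fin n)) 1) : ∑ j, ‖z j‖ ^ 2 = 1 := by
  rw [← EuclideanSpace.norm_sq_eq, mem_sphere_zero_iff_norm.1 hz, one_pow]

/-- On the sphere, `2 + 2 Re (c z_j) = |1 + c z_j|² + ∑_{k ≠ j} |z_k|²` when `|c| = 1`. -/
theorem two_add_mem_sphereSquares {n : ℕ} (j : Fin n) (c : ℂ) (hc : ‖c‖ = 1)
    (a : MvPolynomial (Fin n ⊕ Fin n) ℝ)
    (ha : ∀ z, MvPolynomial.eval (realCoord z) a = 2 * (c * z j).re) :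
    MvPolynomial.C 2 + a ∈ sphereSquares n := by
  refine ⟨Fin n, inferInstance, fun k => if k = j then 1 + MvPolynomial.C c * MvPolynomial.X j
    else MvPolynomial.X k, fun z hz => ?_⟩
  have h1 := sum_norm_sq_eq_one hz
  rw [← Finset.add_sum_erase _ _ (Finset.mem_univ j)] at h1 ⊢
  beta_reduce
  rw [if_pos rfl, Finset.sum_congr rfl (g := fun k => ‖z k‖ ^ 2) fun k hk => by
    rw [if_neg (Finset.ne_of_mem_erase hk), polyEval_X]]
  have h2 : ‖1 + c * z j‖ ^ 2 = 1 + 2 * (c * z j).re + ‖z j‖ ^ 2 := by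
    have : ‖c * z j‖ ^ 2 = ‖z j‖ ^ 2 := by rw [norm_mul, hc, one_mul]
    rw [← this, Complex.sq_norm, Complex.sq_norm, Complex.normSq_add]
    simp
    ring
  rw [polyEval_add, polyEval_one, polyEval_mul, polyEval_C, polyEval_X, h2, map_add, ha,
    MvPolynomial.eval_C]
  linarith

/-- The archimedean property. Two-sided bounds hold for the coordinates and pass to products, since
2(NM ± xy) = (N + x)(M ± y) + (N - x)(M ∓ y). -/
theorem exists_C_add_mem_and_C_sub_mem_sphereSquares {n : ℕ}
    (a : MvPolynomial (Fin n ⊕ Fin n) ℝ) :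
    ∃ N : ℝ, MvPolynomial.C N + a ∈ sphereSquares n ∧ MvPolynomial.C N - a ∈ sphereSquares n := by
  have hC : ∀ {x} (c : ℝ), 0 ≤ c → x ∈ sphereSquares n → MvPolynomial.C c * x ∈ sphereSquares n :=
    fun c hc hx => (sphereSquares n).mul_mem (C_mem_sphereSquares hc) hx
  have hhalf : (MvPolynomial.C (1 / 2) : MvPolynomial (Fin n ⊕ Fin n) ℝ) * 2 = 1 := by
    rw [show (2 : MvPolynomial (Fin n ⊕ Fin n) ℝ) = MvPolynomial.C 2
      from (map_ofNat _ 2).symm, ← map_mul]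
    norm_num
  induction a using MvPolynomial.induction_on with
  | C c =>
    refine ⟨|c|, ?_, ?_⟩
    · rw [← map_add]; exact C_mem_sphereSquares (by linarith [neg_abs_le c])
    · rw [← map_sub]; exact C_mem_sphereSquares (by linarith [le_abs_self c])
  | add x y hx hy =>
    obtain ⟨N, hN, hN'⟩ := hx
    obtain ⟨M, hM, hM'⟩ := hy
    refine ⟨N + M, ?_, ?_⟩
    · convert (sphereSquares n).add_mem hN hM using 1; rw [map_add]; ring
    · convert (sphereSquares n).add_mem hN' hM' using 1; rw [map_add]; ring
  | mul_X x j hx =>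
    obtain ⟨N, hN, hN'⟩ := hx
    obtain ⟨M, hM, hM'⟩ : ∃ M : ℝ, MvPolynomial.C M + MvPolynomial.X j ∈ sphereSquares n ∧
        MvPolynomial.C M - MvPolynomial.X j ∈ sphereSquares n := by
      have h : ∀ (k : Fin n) (c : ℂ), ‖c‖ = 1 →
          (∀ z : EuclideanSpace ℂ (Fin n), realCoord z j = (c * z k).re) →
          ∃ M : ℝ, MvPolynomial.C M + MvPolynomial.X j ∈ sphereSquares n ∧
            MvPolynomial.C M - MvPolynomial.X j ∈ sphereSquares n := by
        intro k c hc hz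
        have e1 := two_add_mem_sphereSquares k c hc (2 * MvPolynomial.X j) fun z => by simp [hz]
        have e2 := two_add_mem_sphereSquares k (-c) (by simpa using hc) (-(2 * MvPolynomial.X j))
          fun z => by simp [hz]; ring
        have h2 : (MvPolynomial.C 2 : MvPolynomial (Fin n ⊕ Fin n) ℝ) = 2 := map_ofNat _ 2
        refine ⟨1, ?_, ?_⟩
        · convert hC (1 / 2) (by norm_num) e1 using 1
          rw [h2, map_one]
          linear_combination -(1 + MvPolynomial.X j) * hhalf
        · convert hC (1 / 2) (by norm_num) e2 using 1
          rw [h2, map_one]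
          linear_combination -(1 - MvPolynomial.X j) * hhalf
      -- Re z_k and Im z_k = Re(-i z_k) are the cases c = 1 and c = -i.
      rcases j with k | k
      · exact h k 1 (by simp) fun z => by simp [realCoord]
      · exact h k (-Complex.I) (by simp) fun z => by simp [realCoord]
    have mul := @(sphereSquares n).mul_mem
    have add := @(sphereSquares n).add_mem
    refine ⟨N * M, ?_, ?_⟩
    · convert hC (1 / 2) (by norm_num) (add (mul hN hM) (mul hN' hM')) using 1
      rw [map_mul]
      linear_combination
        -(MvPolynomial.C N * MvPolynomial.C M + x * MvPolynomial.X j) * hhalf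
    · convert hC (1 / 2) (by norm_num) (add (mul hN hM') (mul hN' hM)) using 1
      rw [map_mul]
      linear_combination
        -(MvPolynomial.C N * MvPolynomial.C M - x * MvPolynomial.X j) * hhalf

/-- A real polynomial that is positive on the unit sphere of `ℂⁿ` agrees there with a sum of
squared norms of holomorphic polynomials. -/
theorem mem_sphereSquares_of_pos {n : ℕ} (a : MvPolynomial (Fin n ⊕ Fin n) ℝ)
    (ha : ∀ z ∈ Metric.sphere (0 : EuclideanSpace ℂ (Fin n)) 1,
      0 < MvPolynomial.eval (realCoord z) a) : a ∈ sphereSquares n := by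
  refine mem_of_forall_algHom_pos (sphereSquares n) (fun c hc => C_mem_sphereSquares hc)
    (fun b => (exists_C_add_mem_and_C_sub_mem_sphereSquares b).imp fun N h => h.1) a fun φ hφ => ?_
  let z : EuclideanSpace ℂ (Fin n) := WithLp.toLp 2 fun j =>
    ⟨φ (MvPolynomial.X (Sum.inl j)), φ (MvPolynomial.X (Sum.inr j))⟩
  have hφz : ∀ b, φ b = MvPolynomial.eval (realCoord z) b := by
    intro b
    have : φ = MvPolynomial.aeval (realCoord z) := by
      ext j
      rcases j with j | j <;> simp [realCoord, z]
    rw [this, MvPolynomial.aeval_eq_eval]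
  rw [hφz]
  apply ha
  -- Both s = ‖z‖² - 1 and -s vanish on the sphere, so both lie in the semiring; nonnegativity of φ
  -- on both puts its point on the sphere.
  let s : MvPolynomial (Fin n ⊕ Fin n) ℝ :=
    ∑ j, (MvPolynomial.X (Sum.inl j) ^ 2 + MvPolynomial.X (Sum.inr j) ^ 2) - 1
  have hs : ∀ w : EuclideanSpace ℂ (Fin n),
      MvPolynomial.eval (realCoord w) s = ∑ j, ‖w j‖ ^ 2 - 1 := by
    intro w
    simp only [Complex.sq_norm, Complex.normSq_apply]
    simp [s, realCoord, sq]
  have h1 := hφ s (mem_sphereSquares_of_eq_zero fun w hw => by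
    rw [hs, sum_norm_sq_eq_one hw, sub_self])
  have h2 := hφ (-s) (mem_sphereSquares_of_eq_zero fun w hw => by
    rw [map_neg, hs, sum_norm_sq_eq_one hw, sub_self, neg_zero])
  rw [hφz, hs] at h1
  rw [hφz, map_neg, hs] at h2
  rw [mem_sphere_zero_iff_norm, EuclideanSpace.norm_eq, Real.sqrt_eq_one]
  linarith

theorem exists_re_im_polyEval {n : ℕ} (f : MvPolynomial (Fin n) ℂ) :
    ∃ u v : MvPolynomial (Fin n ⊕ Fin n) ℝ, ∀ z, (polyEval f z).re =
      MvPolynomial.eval (realCoord z) u ∧ (polyEval f z).im = MvPolynomial.eval (realCoord z) v := by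
  induction f using MvPolynomial.induction_on with
  | C c => exact ⟨MvPolynomial.C c.re, MvPolynomial.C c.im, fun z => by simp [polyEval_C]⟩
  | add f g hf hg =>
    obtain ⟨u, v, h⟩ := hf
    obtain ⟨u', v', h'⟩ := hg
    exact ⟨u + u', v + v', fun z => by simp [polyEval_add, h z, h' z]⟩
  | mul_X f j hf =>
    obtain ⟨u, v, h⟩ := hf
    refine ⟨u * MvPolynomial.X (Sum.inl j) - v * MvPolynomial.X (Sum.inr j),
      u * MvPolynomial.X (Sum.inr j) + v * MvPolynomial.X (Sum.inl j), fun z => ?_⟩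
    simp [polyEval_mul, polyEval_X, h z, realCoord]

/-- If `|r|² > δ` on the unit sphere, then `|r|² - δ` is there a sum of squared norms. -/
theorem exists_sum_norm_sq_eq_sub {n : ℕ} (r : MvPolynomial (Fin n) ℂ) (δ : ℝ)
    (hr : ∀ z ∈ Metric.sphere (0 : EuclideanSpace ℂ (Fin n)) 1, δ < ‖polyEval r z‖ ^ 2) :
    ∃ (ι : Type) (_ : Fintype ι) (p : ι → MvPolynomial (Fin n) ℂ),
      ∀ z ∈ Metric.sphere (0 : EuclideanSpace ℂ (Fin n)) 1,
        ∑ i, ‖polyEval (p i) z‖ ^ 2 = ‖polyEval r z‖ ^ 2 - δ := by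
  obtain ⟨u, v, h⟩ := exists_re_im_polyEval r
  have he : ∀ z, MvPolynomial.eval (realCoord z) (u ^ 2 + v ^ 2 - MvPolynomial.C δ) =
      ‖polyEval r z‖ ^ 2 - δ := fun z => by
    rw [Complex.sq_norm, Complex.normSq_apply]
    simp [h z, sq]
  obtain ⟨ι, hι, p, hp⟩ := mem_sphereSquares.1 (mem_sphereSquares_of_pos
    (u ^ 2 + v ^ 2 - MvPolynomial.C δ) fun z hz => by rw [he]; linarith [hr z hz])
  exact ⟨ι, hι, p, fun z hz => by rw [← hp z hz, he]⟩

/-! ### From unit norm on the sphere to proper maps of balls -/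

theorem norm_quotientMap_sq {n N : ℕ} (p : Fin N → MvPolynomial (Fin n) ℂ)
    (r : MvPolynomial (Fin n) ℂ) (z : EuclideanSpace ℂ (Fin n)) :
    ‖quotientMap p r z‖ ^ 2 = (∑ i, ‖polyEval (p i) z‖ ^ 2) / ‖polyEval r z‖ ^ 2 := by
  simp [EuclideanSpace.norm_sq_eq, quotientMap, div_pow, Finset.sum_div]

theorem differentiableOn_quotientMap {n N : ℕ} {p : Fin N → MvPolynomial (Fin n) ℂ}
    {r : MvPolynomial (Fin n) ℂ} {s : Set (EuclideanSpace ℂ (Fin n))}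
    (hr : ∀ z ∈ s, polyEval r z ≠ 0) : DifferentiableOn ℂ (quotientMap p r) s := by
  rw [differentiableOn_euclidean]
  intro i
  simp only [quotientMap, div_eq_mul_inv]
  exact (differentiable_polyEval (p i)).differentiableOn.mul
    ((differentiable_polyEval r).differentiableOn.fun_inv hr)

theorem norm_quotientMap_eq_one {n N : ℕ} {p : Fin N → MvPolynomial (Fin n) ℂ}
    {r : MvPolynomial (Fin n) ℂ} {z : EuclideanSpace ℂ (Fin n)} (hr : polyEval r z ≠ 0)
    (h : ∑ i, ‖polyEval (p i) z‖ ^ 2 = ‖polyEval r z‖ ^ 2) : ‖quotientMap p r z‖ = 1 := by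
  have : ‖quotientMap p r z‖ ^ 2 = 1 := by
    rw [norm_quotientMap_sq, h, div_self (by simpa using hr)]
  exact (pow_eq_one_iff_of_nonneg (norm_nonneg _) two_ne_zero).1 this

/-- A compact K in the open ball contains no vector of norm 1, so its preimage in the closed ball
misses the sphere; it is closed in a compact set. -/
theorem isProperMap_restrict_quotientMap {n N : ℕ} {p : Fin N → MvPolynomial (Fin n) ℂ}
    {r : MvPolynomial (Fin n) ℂ} (hr : ∀ z ∈ closedUnitBall n, polyEval r z ≠ 0)
    (hmaps : Set.MapsTo (quotientMap p r) (unitBall n) (unitBall N))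
    (hsphere : ∀ z ∈ Metric.sphere (0 : EuclideanSpace ℂ (Fin n)) 1, ‖quotientMap p r z‖ = 1) :
    IsProperMap hmaps.restrict := by
  have hcont : ContinuousOn (quotientMap p r) (closedUnitBall n) :=
    (differentiableOn_quotientMap hr).continuousOn
  refine isProperMap_iff_isCompact_preimage.2
    ⟨(hcont.mono Metric.ball_subset_closedBall).mapsToRestrict hmaps, fun K hK => ?_⟩
  rw [Subtype.isCompact_iff] at hK ⊢
  have himage : Subtype.val '' (hmaps.restrict ⁻¹' K) =
      closedUnitBall n ∩ quotientMap p r ⁻¹' (Subtype.val '' K) := by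
    ext z
    constructor
    · rintro ⟨w, hw, rfl⟩
      exact ⟨Metric.ball_subset_closedBall w.2, _, hw, rfl⟩
    · rintro ⟨hz, w, hw, hwz⟩
      have hzb : z ∈ unitBall n := by
        rw [unitBall, ← Metric.closedBall_sdiff_sphere]
        refine ⟨hz, fun hzs => ?_⟩
        have h1 := mem_ball_zero_iff.1 w.2
        rw [hwz, hsphere z hzs] at h1
        exact lt_irrefl _ h1
      refine ⟨⟨z, hzb⟩, ?_, rfl⟩
      have h : Set.MapsTo.restrict _ _ _ hmaps ⟨z, hzb⟩ = w :=
        Subtype.ext hwz.symm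
      rwa [Set.mem_preimage, h]
  rw [himage]
  exact (isCompact_closedBall _ _).of_isClosed_subset
    (hcont.preimage_isClosed_of_isClosed Metric.isClosed_closedBall hK.isClosed)
    Set.inter_subset_left

/-- The maximum principle gives norm at most 1; equality at an interior point would make the map
constant. -/
theorem mapsTo_quotientMap {n N : ℕ} (hn : n ≠ 0) {p : Fin N → MvPolynomial (Fin n) ℂ}
    {r : MvPolynomial (Fin n) ℂ} (hr : ∀ z ∈ closedUnitBall n, polyEval r z ≠ 0)
    (hsphere : ∀ z ∈ Metric.sphere (0 : EuclideanSpace ℂ (Fin n)) 1, ‖quotientMap p r z‖ = 1)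
    (hnonconst : ∀ w, ∃ z ∈ unitBall n, quotientMap p r z ≠ w) :
    Set.MapsTo (quotientMap p r) (unitBall n) (unitBall N) := by
  have : Nonempty (Fin n) := Fin.pos_iff_nonempty.1 (Nat.pos_of_ne_zero hn)
  have hd := differentiableOn_quotientMap (p := p) hr
  have hd' : DiffContOnCl ℂ (quotientMap p r) (unitBall n) :=
    DifferentiableOn.diffContOnCl (by rwa [closure_ball _ one_ne_zero])
  have hle : ∀ z ∈ unitBall n, ‖quotientMap p r z‖ ≤ 1 := fun z hz =>
    Complex.norm_le_of_forall_mem_frontier_norm_le Metric.isBounded_ball hd'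
      (fun w hw => (hsphere w (Metric.frontier_ball_subset_sphere hw)).le) (subset_closure hz)
  intro z hz
  rw [mem_ball_zero_iff]
  refine (hle z hz).lt_of_ne fun h1 => ?_
  obtain ⟨w, hw, hne⟩ := hnonconst (quotientMap p r z)
  exact hne (Complex.eqOn_of_isPreconnected_of_isMaxOn_norm (convex_ball _ _).isPreconnected
    Metric.isOpen_ball hd'.differentiableOn hz (fun w hw => by simpa [h1] using hle w hw) hw)

/-! ### Construction of the numerator and conclusion -/

theorem exists_fin_family {ι : Type} [Fintype ι] {n : ℕ} (p : ι → MvPolynomial (Fin n) ℂ) :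
    ∃ (N : ℕ) (p' : Fin N → MvPolynomial (Fin n) ℂ), (∀ i, ∃ j, p' j = p i) ∧
      ∀ z, ∑ j, ‖polyEval (p' j) z‖ ^ 2 = ∑ i, ‖polyEval (p i) z‖ ^ 2 :=
  ⟨_, p ∘ (Fintype.equivFin ι).symm, fun i => ⟨Fintype.equivFin ι i, by simp⟩, fun z =>
    (Fintype.equivFin ι).symm.sum_comp fun i => ‖polyEval (p i) z‖ ^ 2⟩

/-- A polynomial `r` without zeros on the closed ball, `n ≥ 1`, satisfies on the sphere
`|r|² = ε² + ε² ‖z‖² + ∑ |p_i|²` for some `ε > 0`. -/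
theorem exists_numerator {n : ℕ} {r : MvPolynomial (Fin n) ℂ}
    (hr : ∀ z ∈ closedUnitBall n, polyEval r z ≠ 0) :
    ∃ (ε : ℝ) (N : ℕ) (p : Fin N → MvPolynomial (Fin n) ℂ), 0 < ε ∧
      (∃ i, p i = MvPolynomial.C (ε : ℂ)) ∧
      (∀ k, ∃ i, p i = MvPolynomial.C (ε : ℂ) * MvPolynomial.X k) ∧
      ∀ z ∈ Metric.sphere (0 : EuclideanSpace ℂ (Fin n)) 1,
        ∑ i, ‖polyEval (p i) z‖ ^ 2 = ‖polyEval r z‖ ^ 2 := by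
  obtain ⟨w, hw, hmin⟩ := (isCompact_closedBall (0 : EuclideanSpace ℂ (Fin n)) 1).exists_isMinOn
    ⟨0, by simp⟩ (differentiable_polyEval r).continuous.norm.continuousOn
  set m := ‖polyEval r w‖ with hm
  have hm0 : 0 < m := norm_pos_iff.2 (hr w hw)
  -- With ε = m / 2, the amount 2ε² = m² / 2 reserved for ε and the ε z_k is below m² ≤ |r|².
  obtain ⟨ι, _, p, hp⟩ := exists_sum_norm_sq_eq_sub r (2 * (m / 2) ^ 2) fun z hz => by
    have : m ≤ ‖polyEval r z‖ := hmin (Metric.sphere_subset_closedBall hz)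
    nlinarith
  obtain ⟨N, p', hmem, hsum⟩ := exists_fin_family (Sum.elim
    (Sum.elim (fun _ : Unit => MvPolynomial.C ((m / 2 : ℝ) : ℂ))
      fun k => MvPolynomial.C ((m / 2 : ℝ) : ℂ) * MvPolynomial.X k) p)
  refine ⟨m / 2, N, p', by positivity, hmem (Sum.inl (Sum.inl ())),
    fun k => hmem (Sum.inl (Sum.inr k)), fun z hz => ?_⟩
  rw [hsum]
  have h1 : ∀ k, ‖polyEval (MvPolynomial.C ((m / 2 : ℝ) : ℂ) * MvPolynomial.X k) z‖ ^ 2 =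
      (m / 2) ^ 2 * ‖z k‖ ^ 2 := fun k => by
    rw [polyEval_mul, polyEval_C, polyEval_X, norm_mul, mul_pow, Complex.norm_real,
      Real.norm_eq_abs, sq_abs]
  simp only [Fintype.sum_sum_type, Sum.elim_inl, Sum.elim_inr, hp z hz, h1, ← Finset.mul_sum,
    sum_norm_sq_eq_one hz, polyEval_C, Complex.norm_real, Real.norm_eq_abs, sq_abs,
    Finset.univ_unique, Finset.sum_singleton]
  ring

theorem theorem4 (n : ℕ) (q : MvPolynomial (Fin n) ℂ) (hq0 : polyEval q 0 = 0)
    (hq : ∀ z ∈ closedUnitBall n, ‖polyEval q z‖ < 1) :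
    ∃ (N : ℕ) (p : Fin N → MvPolynomial (Fin n) ℂ),
      IsProperRationalBallMap p (1 + q) ∧ IsReducedToLowestTerms p (1 + q) := by
  have hr : ∀ z ∈ closedUnitBall n, polyEval (1 + q) z ≠ 0 := by
    intro z hz h
    rw [polyEval_add, polyEval_one] at h
    have h1 := hq z hz
    rw [eq_neg_of_add_eq_zero_right h, norm_neg, norm_one] at h1
    exact lt_irrefl _ h1
  have hr' : ∀ z ∈ unitBall n, polyEval (1 + q) z ≠ 0 := fun z hz =>
    hr z (Metric.ball_subset_closedBall hz)
  rcases eq_or_ne n 0 with rfl | hn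
  -- For n = 0 the sphere is empty and q(0) = 0 forces r = 1, so the map to the point B_0 works.
  · have hq' : q = 0 := by
      rw [MvPolynomial.eq_C_of_isEmpty q] at hq0 ⊢
      rw [polyEval_C] at hq0
      rw [hq0, map_zero]
    have hmaps : Set.MapsTo (quotientMap (N := 0) (fun _ => 0) (1 + q)) (unitBall 0)
        (unitBall 0) := fun z _ => by simp [Subsingleton.elim (quotientMap _ _ z) 0]
    refine ⟨0, fun _ => 0, ⟨hr', hmaps, isProperMap_restrict_quotientMap hr hmaps fun z hz => ?_⟩,
      fun h hdvd _ => isUnit_of_dvd_one (by simpa [hq'] using hdvd)⟩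
    simp [Subsingleton.elim z 0] at hz
  · obtain ⟨ε, N, p, hε, ⟨i₀, hi₀⟩, hX, hsum⟩ := exists_numerator hr
    have hε' : (ε : ℂ) ≠ 0 := by exact_mod_cast hε.ne'
    have hsphere : ∀ z ∈ Metric.sphere (0 : EuclideanSpace ℂ (Fin n)) 1,
        ‖quotientMap p (1 + q) z‖ = 1 := fun z hz =>
      norm_quotientMap_eq_one (hr z (Metric.sphere_subset_closedBall hz)) (hsum z hz)
    have hmaps : Set.MapsTo (quotientMap p (1 + q)) (unitBall n) (unitBall N) := by
      refine mapsTo_quotientMap hn hr hsphere fun w => ?_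
      -- The component ε z_k / r vanishes at 0 but not at e_k / 2.
      by_contra! hconst
      let k : Fin n := ⟨0, Nat.pos_of_ne_zero hn⟩
      obtain ⟨i₁, hi₁⟩ := hX k
      let z : EuclideanSpace ℂ (Fin n) := EuclideanSpace.single k (1 / 2 : ℂ)
      have hz : z ∈ unitBall n := by simp [z]; norm_num
      have h0 : (0 : EuclideanSpace ℂ (Fin n)) ∈ unitBall n := by simp
      have e1 : w i₁ = 0 := by
        rw [← hconst 0 h0]
        simp [quotientMap, hi₁, polyEval_mul, polyEval_X]
      rw [← hconst z hz] at e1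
      refine div_ne_zero ?_ (hr' z hz) e1
      rw [hi₁, polyEval_mul, polyEval_C, polyEval_X]
      simp [z, hε']
    refine ⟨N, p, ⟨hr', hmaps, isProperMap_restrict_quotientMap hr hmaps hsphere⟩,
      fun h _ hdvd => isUnit_of_dvd_unit (hdvd i₀) ?_⟩
    rw [hi₀]
    exact (isUnit_iff_ne_zero.2 hε').map MvPolynomial.C
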